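/- **Definitions.** For a lattice $L$, the *dimension monoid* $\operatorname{Dim} L$ is the commutative monoid defined by generators $\Delta(x,y)$, for $x\le y$ in $L$, and relations - $\Delta(x,x)=0$, for all $x\in L$; - $\Delta(x,z)=\Delta(x,y)+\Delta(y,z)$, for all $x\le y\le z$ in $L$; - $\Delta(x\wedge y,x)=\Delta(y,x\vee y)$, for all $x,y\in L$. For commutative monoids $M$ and $N$, a monoid homomorphism $\mu\colon M\to N$ is a *V-homomorphism* if, whenever $c\in M$ and $\bar a,\bar b\in N$ satisfy $\mu(c)=\bar a+\bar b$, there are $a,b\in M$ such that $c=a+b$, $\mu(a)=\bar a$ and $\mu(b)=\bar b$. A *pointed partially ordered abelian group* is a pair $(G,e)$ where $G$ is a partially ordered abelian group and $0\le e$ in $G$; a homomorphism of pointed partially ordered abelian groups is an order-preserving group homomorphism that preserves the distinguished elements. Let $\mathcal D$ be the class of all triples $(H,e,\bowtie)$, where $(H,e)$ is a pointed partially ordered abelian group and $\bowtie\colon H^4\to H$ is a map, such that - $H$ is unperforated: $mx\ge 0$ implies $x\ge 0$, for all $x\in H$ and all integers $m\geq 1$; - $e$ has index at most $2$: $0\le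 3x\le e$ implies $x=0$, for all $x\in H$; - $\bowtie$ is an interpolator: for all $x,x',y,y'\in H$, if each of $x,x'$ is less than or equal to each of $y,y'$, then $x,x'\le{\bowtie}(x,x',y,y')\le y,y'$; and in all cases ${\bowtie}(x,x',y,y')={\bowtie}(x',x,y,y')={\bowtie}(x,x',y',y)$. For a pointed partially ordered abelian group $G$, let $j_G\colon G\to\mathbf I(G)$ be the universal homomorphism of pointed partially ordered abelian groups from $G$ to a member $\mathbf I(G)$ of $\mathcal D$: every homomorphism of pointed partially ordered abelian groups from $G$ to a member $H$ of $\mathcal D$ factors through $j_G$ by a unique homomorphism $\mathbf I(G)\to H$ of pointed partially ordered abelian groups that also preserves $\bowtie$. For a set $X$, let $(\mathbf E(X),e)$ be the pointed partially ordered abelian group defined by generators $a_\xi$, for $\xi\in X$, and relations $0\le a_\xi\le e$, for $\xi\in X$. Put $\mathbf F(X)=\mathbf I(\mathbf E(X))$, denote again by $e$ the distinguished element of $\mathbf F(X)$, and let $\mathbf F(X)^+=\{x\in\mathbf F(X) : x\ge 0\}$, a commutative monoid under addition. **Theorem.** Let $X$ be a set, let $L$ be a lattice, and let $\mu\colon\operatorname{Dim}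 L\to\mathbf F(X)^+$ be a V-homomorphism whose image contains $e$. Then $|X|\le\aleph_1$. -/

import Mathlib

universe u v

namespace DimGroup

/-! ### The dimension monoid of a lattice -/

/-- The generators `Δ(x, y)`, for `x ≤ y` in `L`. -/
abbrev Interval (L : Type u) [Lattice L] : Type u := {p : L × L // p.1 ≤ p.2}

/-- The formal generator `Δ(x, y)`, in the free commutative monoid on all intervals of `L`. -/
def formalDelta {L : Type u} [Lattice L] (x y : L) (h : x ≤ y) : Multiset (Interval L) :=
  {⟨(x, y), h⟩}

/-- The defining relations (D0), (D1), (D2) of the dimension monoid. -/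
inductive DimRel (L : Type u) [Lattice L] : Multiset (Interval L) → Multiset (Interval L) → Prop
  | d0 (x : L) : DimRel L (formalDelta x x le_rfl) 0
  | d1 (x y z : L) (hxy : x ≤ y) (hyz : y ≤ z) :
      DimRel L (formalDelta x z (hxy.trans hyz)) (formalDelta x y hxy + formalDelta y z hyz)
  | d2 (x y : L) :
      DimRel L (formalDelta (x ⊓ y) x inf_le_left) (formalDelta y (x ⊔ y) le_sup_right)

/-- The dimension monoid `Dim L`: the commutative monoid presented by the generators `Δ(x, y)`
(`x ≤ y` in `L`) and the relations `DimRel L`. -/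
abbrev Dim (L : Type u) [Lattice L] : Type u := (addConGen (DimRel L)).Quotient

/-- A V-homomorphism of commutative monoids. -/
def IsVHom {M : Type u} {N : Type v} [AddCommMonoid M] [AddCommMonoid N] (μ : M →+ N) : Prop :=
  ∀ (c : M) (a' b' : N), μ c = a' + b' → ∃ a b : M, c = a + b ∧ μ a = a' ∧ μ b = b'

/-! ### The pointed partially ordered abelian group `E(X)` -/

/-- The underlying group of `E(X)`: the free abelian group on `e` and the `a ξ`, for `ξ : X`.
The pair `(m, n)` stands for `m e + ∑ ξ, n ξ • a ξ`. -/
def E (X : Type u) : Type u := ℤ × (X →₀ ℤ)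

namespace E

variable {X : Type u}

noncomputable instance : AddCommGroup (E X) := inferInstanceAs (AddCommGroup (ℤ × (X →₀ ℤ)))

/-- The distinguished element of `E(X)`. -/
noncomputable def e (X : Type u) : E X := ((1 : ℤ), (0 : X →₀ ℤ))

/-- The generators `a ξ` of `E(X)`. -/
noncomputable def a (ξ : X) : E X := ((0 : ℤ), Finsupp.single ξ (1 : ℤ))

/-- The positive cone of `E(X)`, generated by the relations `0 ≤ e` and `0 ≤ a ξ ≤ e`. -/
noncomputable def cone (X : Type u) : AddSubmonoid (E X) :=
  AddSubmonoid.closure ({e X} ∪ Set.range (fun ξ : X => a ξ) ∪ Set.range (fun ξ : X => e X - a ξ))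

theorem cone_nonneg {x : E X} (hx : x ∈ cone X) : 0 ≤ x.1 ∧ ∀ ξ, 0 ≤ x.1 + x.2 ξ := by
  classical
  induction hx using AddSubmonoid.closure_induction with
  | mem x hx =>
    rcases hx with (hx | ⟨η, rfl⟩) | ⟨η, rfl⟩
    · rw [Set.mem_singleton_iff] at hx
      subst hx
      exact ⟨zero_le_one, fun ξ => by
        change (0 : ℤ) ≤ 1 + (0 : X →₀ ℤ) ξ
        simp⟩
    · refine ⟨le_rfl, fun ξ => ?_⟩
      change (0 : ℤ) ≤ 0 + Finsupp.single η (1 : ℤ) ξ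
      rw [Finsupp.single_apply]
      split_ifs <;> simp
    · refine ⟨?_, fun ξ => ?_⟩
      · change (0 : ℤ) ≤ 1 - 0
        simp
      · change (0 : ℤ) ≤ (1 - 0) + ((0 : X →₀ ℤ) - Finsupp.single η (1 : ℤ)) ξ
        rw [Finsupp.sub_apply, Finsupp.single_apply]
        split_ifs <;> simp
  | zero => exact ⟨le_rfl, fun ξ => le_rfl⟩
  | add x y _ _ hx hy =>
    refine ⟨add_nonneg hx.1 hy.1, fun ξ => ?_⟩
    have h := add_nonneg (hx.2 ξ) (hy.2 ξ)
    change (0 : ℤ) ≤ (x.1 + y.1) + (x.2 ξ + y.2 ξ)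
    linarith

/-- The order of `E(X)`, given by its positive cone. -/
noncomputable instance : PartialOrder (E X) where
  le x y := y - x ∈ cone X
  le_refl x := by
    rw [sub_self]
    exact zero_mem _
  le_trans x y z hxy hyz := by
    have h := add_mem hyz hxy
    rwa [sub_add_sub_cancel] at h
  le_antisymm x y hxy hyx := by
    have h := cone_nonneg hxy
    have h' := cone_nonneg hyx
    have h1 : (0 : ℤ) ≤ y.1 - x.1 := h.1
    have h2 : (0 : ℤ) ≤ x.1 - y.1 := h'.1
    have h0 : x.1 = y.1 := by linarith
    refine Prod.ext h0 (Finsupp.ext fun ξ => ?_)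
    have h3 : (0 : ℤ) ≤ (y.1 - x.1) + (y.2 ξ - x.2 ξ) := h.2 ξ
    have h4 : (0 : ℤ) ≤ (x.1 - y.1) + (x.2 ξ - y.2 ξ) := h'.2 ξ
    linarith

instance : IsOrderedAddMonoid (E X) where
  add_le_add_left x y hxy z := by
    change (y + z) - (x + z) ∈ cone X
    rwa [add_sub_add_right_eq_sub]

end E

/-! ### The free interpolator construction `I(G)` -/

/-- Terms over a group `G` in the group operations and a quaternary operation symbol `interp`. -/
inductive ITerm (G : Type u) : Type u
  | of : G → ITerm G
  | add : ITerm G → ITerm G → ITerm G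
  | neg : ITerm G → ITerm G
  | interp : ITerm G → ITerm G → ITerm G → ITerm G → ITerm G

namespace ITerm

variable {G : Type u} [AddCommGroup G] [PartialOrder G]

/-- The term `t + ⋯ + t`, with `m` summands. -/
def smul : ℕ → ITerm G → ITerm G
  | 0, _ => of 0
  | m + 1, t => add (smul m t) t

/-- The inequalities between terms over `G` that follow from the order and the addition of `G`,
from the axioms of partially ordered abelian groups, and from the axioms: `0 ≤ e`, unperforation,
`e` has index at most `2`, `interp` is an interpolator. Equality of terms is the conjunction of the
two inequalities, and `interp` respects it. -/
inductive Le (e : G) : ITerm G → ITerm G → Prop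
  | refl (s) : Le e s s
  | trans {s t r} : Le e s t → Le e t r → Le e s r
  -- the order and the addition of `G`
  | of_le {g h : G} : g ≤ h → Le e (of g) (of h)
  | of_add_le (g h : G) : Le e (of (g + h)) (add (of g) (of h))
  | of_add_ge (g h : G) : Le e (add (of g) (of h)) (of (g + h))
  -- partially ordered abelian groups
  | add_assoc_le (s t r) : Le e (add (add s t) r) (add s (add t r))
  | add_assoc_ge (s t r) : Le e (add s (add t r)) (add (add s t) r)
  | add_comm (s t) : Le e (add s t) (add t s)
  | zero_add_le (s) : Le e (add (of 0) s) s
  | zero_add_ge (s) : Le e s (add (of 0) s)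
  | neg_add_le (s) : Le e (add (neg s) s) (of 0)
  | neg_add_ge (s) : Le e (of 0) (add (neg s) s)
  | add_mono {s t} (r) : Le e s t → Le e (add s r) (add t r)
  | neg_anti {s t} : Le e s t → Le e (neg t) (neg s)
  -- the distinguished element is positive
  | point : Le e (of 0) (of e)
  -- unperforation
  | unperf {m : ℕ} {s} : 0 < m → Le e (of 0) (smul m s) → Le e (of 0) s
  -- index at most two (the inequality `0 ≤ s` already follows from unperforation)
  | index {s} : Le e (of 0) (smul 3 s) → Le e (smul 3 s) (of e) → Le e s (of 0)
  -- interpolation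
  | interp_left {s s' t t'} : Le e s t → Le e s t' → Le e s' t → Le e s' t' →
      Le e s (interp s s' t t')
  | interp_left' {s s' t t'} : Le e s t → Le e s t' → Le e s' t → Le e s' t' →
      Le e s' (interp s s' t t')
  | interp_right {s s' t t'} : Le e s t → Le e s t' → Le e s' t → Le e s' t' →
      Le e (interp s s' t t') t
  | interp_right' {s s' t t'} : Le e s t → Le e s t' → Le e s' t → Le e s' t' →
      Le e (interp s s' t t') t'
  -- symmetry
  | interp_swap_left (s s' t t') : Le e (interp s s' t t') (interp s' s t t')
  | interp_swap_right (s s' t t') : Le e (interp s s' t t') (interp s s' t' t)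
  -- `interp` is well defined modulo equality
  | interp_congr {s₁ s₂ s₁' s₂' t₁ t₂ t₁' t₂'} :
      Le e s₁ s₂ → Le e s₂ s₁ → Le e s₁' s₂' → Le e s₂' s₁' →
      Le e t₁ t₂ → Le e t₂ t₁ → Le e t₁' t₂' → Le e t₂' t₁' →
      Le e (interp s₁ s₁' t₁ t₁') (interp s₂ s₂' t₂ t₂')

/-- Equality of terms modulo the axioms. -/
def setoid (e : G) : Setoid (ITerm G) where
  r s t := Le e s t ∧ Le e t s
  iseqv :=
    { refl := fun s => ⟨.refl s, .refl s⟩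
      symm := fun h => ⟨h.2, h.1⟩
      trans := fun h h' => ⟨h.1.trans h'.1, h'.2.trans h.2⟩ }

theorem Le.add_le {e : G} {s s' t t' : ITerm G} (h : Le e s s') (h' : Le e t t') :
    Le e (add s t) (add s' t') :=
  (h.add_mono t).trans (((Le.add_comm s' t).trans (h'.add_mono s')).trans (.add_comm t' s'))

end ITerm

/-- The structure `I(G)` for a partially ordered abelian group `G` with distinguished
element `e`. -/
def I (G : Type u) [AddCommGroup G] [PartialOrder G] (e : G) : Type u :=
  Quotient (ITerm.setoid e)

namespace I

variable {G : Type u} [AddCommGroup G] [PartialOrder G] {e : G}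

instance : Zero (I G e) := ⟨Quotient.mk _ (.of 0)⟩

instance : Add (I G e) :=
  ⟨Quotient.map₂ ITerm.add fun _ _ h _ _ h' => ⟨h.1.add_le h'.1, h.2.add_le h'.2⟩⟩

instance : Neg (I G e) :=
  ⟨Quotient.map ITerm.neg fun _ _ h => ⟨h.2.neg_anti, h.1.neg_anti⟩⟩

instance : AddCommGroup (I G e) where
  nsmul := nsmulRec
  zsmul := zsmulRec
  add_assoc x y z := by
    induction x, y, z using Quotient.inductionOn₃ with
    | _ s t r => exact Quotient.sound ⟨.add_assoc_le s t r, .add_assoc_ge s t r⟩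
  add_comm x y := by
    induction x, y using Quotient.inductionOn₂ with
    | _ s t => exact Quotient.sound ⟨.add_comm s t, .add_comm t s⟩
  zero_add x := by
    induction x using Quotient.inductionOn with
    | _ s => exact Quotient.sound ⟨.zero_add_le s, .zero_add_ge s⟩
  add_zero x := by
    induction x using Quotient.inductionOn with
    | _ s =>
      exact Quotient.sound
        ⟨(ITerm.Le.add_comm s _).trans (.zero_add_le s),
          (ITerm.Le.zero_add_ge s).trans (.add_comm _ s)⟩
  neg_add_cancel x := by
    induction x using Quotient.inductionOn with
    | _ s => exact Quotient.sound ⟨.neg_add_le s, .neg_add_ge s⟩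

instance : PartialOrder (I G e) where
  le := Quotient.lift₂ (ITerm.Le e) fun _ _ _ _ h h' =>
    propext ⟨fun k => (h.2.trans k).trans h'.1, fun k => (h.1.trans k).trans h'.2⟩
  le_refl x := by
    induction x using Quotient.inductionOn with
    | _ s => exact ITerm.Le.refl s
  le_trans x y z := by
    induction x, y, z using Quotient.inductionOn₃ with
    | _ s t r => exact ITerm.Le.trans
  le_antisymm x y := by
    induction x, y using Quotient.inductionOn₂ with
    | _ s t => exact fun h h' => Quotient.sound ⟨h, h'⟩

instance : IsOrderedAddMonoid (I G e) where
  add_le_add_left x y h z := by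
    induction x, y, z using Quotient.inductionOn₃ with
    | _ s t r => exact ITerm.Le.add_mono r h

/-- The canonical map `G → I(G)`. -/
def j (e : G) (g : G) : I G e := Quotient.mk _ (.of g)

/-- The canonical interpolator on `I(G)`. -/
def interp (x x' y y' : I G e) : I G e :=
  Quotient.liftOn₂ x x'
    (fun s s' => Quotient.liftOn₂ y y'
      (fun t t' => (Quotient.mk (ITerm.setoid e) (.interp s s' t t') : I G e))
      (fun _ _ _ _ h h' => Quotient.sound (s := ITerm.setoid e)
        ⟨.interp_congr (.refl _) (.refl _) (.refl _) (.refl _) h.1 h.2 h'.1 h'.2,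
          .interp_congr (.refl _) (.refl _) (.refl _) (.refl _) h.2 h.1 h'.2 h'.1⟩))
    (fun _ _ _ _ h h' => by
      induction y, y' using Quotient.inductionOn₂ with
      | _ t t' =>
        exact Quotient.sound (s := ITerm.setoid e)
          ⟨.interp_congr h.1 h.2 h'.1 h'.2 (.refl _) (.refl _) (.refl _) (.refl _),
            .interp_congr h.2 h.1 h'.2 h'.1 (.refl _) (.refl _) (.refl _) (.refl _)⟩)

end I

/-! ### The group `F(X) = I(E(X))` -/

/-- The dimension group `F(X) = I(E(X))`. -/
abbrev F (X : Type u) : Type u := I (E X) (E.e X)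

/-- The distinguished element of `F(X)`. -/
noncomputable def F.e (X : Type u) : F X := I.j (E.e X) (E.e X)

/-- The distinguished element of `F(X)` is positive. -/
theorem F.e_nonneg (X : Type u) : 0 ≤ F.e X := ITerm.Le.point

end DimGroup

/-!
The proof plays two facts about `F(X)` and `Dim L` against each other.

*Lattices.* A homomorphism from `Dim L` to an abelian group `G` comes from a function `r : L → G`
with `μ Δ(x, y) = r y - r x` (`exists_eq_sub`), and this function is modular:
`r (x ⊓ y) + r (x ⊔ y) = r x + r y`. For a further homomorphism `f : G → ℤ`, modularity implies that
"`f ∘ r` is constant on every interval of the sum" is invariant under the relations of `Dim L`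
(`constOn_iff_of_rel`). If `μ c = e`, apply this to the decompositions `e = a ξ + (e - a ξ)`, lifted
by the V-condition, and to the difference `f` of the homomorphisms `F(X) → ℤ` with `e ↦ 1` that send
`a ξ` to `1`, respectively to `0`, and the other generators to `0`. This gives, for each `ξ`, an
element `z ξ` of one of the finitely many intervals `[u, y]` of `c` such that `r (z ξ) - r u` has the
value `1` under one of these two homomorphisms and `0` under the other one.

*A free triple.* Every element of `F(X)` is the value of a term in finitely many generators. If
`ℵ₁ < |X|`, Kuratowski's free set theorem (`exists_free_triple`) gives `ξ`, `η`, `ζ`, with the same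
interval and the same choice of values, such that the values of `r` at `u`, `z ξ`, `z η` and
`z ξ ⊓ z η` do not involve `ζ`, and similarly for the other two pairs.

*The target.* The group `(Set X → ℤ) × ℤ` with distinguished element `(1, 2)` contains, for each
of the three pairs, the subgroup of the elements `f` that do not depend on the third point and whose
additional coordinate is the sum of two prescribed values of the first component: the values at
`{ξ, η}` and `∅`, at `{η, ζ}` and `∅`, and at `{ξ}` and `{ζ}`. These requirements agree on the
intersections of the subgroups, and each subgroup is determined by its first components, where joins
interpolate. Hence there is an interpolator under which all three subgroups are closed
(`Splitting.bow`), and each of the above elements of `F(X)` is sent into the corresponding subgroup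
(`Splitting.lift_mem`). In the additional coordinate, `z η` then has height `1` above `u`, its meets
with `z ξ` and with `z ζ` have height at least `1`, and `z ξ ⊓ z ζ` has height at most `0`. This
contradicts modularity (`false_of_free_triple`).
-/

universe w

namespace DimGroup

/-! ### The universal property of `I(G)` and of `F(X)` -/

/-- The laws that make a partially ordered abelian group `H` with a distinguished element `u` and
a quaternary operation `bow` a member of the class `𝒟`, in which `I(G)` is universal: `H` is
unperforated, `u` has index at most `2`, and `bow` is a symmetric interpolator. -/
structure InterpLaws {H : Type w} [AddCommGroup H] [PartialOrder H] (u : H)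
    (bow : H → H → H → H → H) : Prop where
  point : 0 ≤ u
  unperf : ∀ (m : ℕ) (x : H), 0 < m → 0 ≤ m • x → 0 ≤ x
  index : ∀ x : H, 0 ≤ 3 • x → 3 • x ≤ u → x ≤ 0
  interp : ∀ x x' y y' : H, x ≤ y → x ≤ y' → x' ≤ y → x' ≤ y' →
    (x ≤ bow x x' y y' ∧ x' ≤ bow x x' y y') ∧ (bow x x' y y' ≤ y ∧ bow x x' y y' ≤ y')
  swap_left : ∀ x x' y y' : H, bow x x' y y' = bow x' x y y'
  swap_right : ∀ x x' y y' : H, bow x x' y y' = bow x x' y' y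

section Lift

variable {G : Type u} [AddCommGroup G] {H : Type w} [AddCommGroup H]

/-- The value in `H` of a term over `G`, for given interpretations of the constants and of the
operation symbol `interp`. -/
def ITerm.eval (φ : G →+ H) (bow : H → H → H → H → H) : ITerm G → H
  | of g => φ g
  | add s t => eval φ bow s + eval φ bow t
  | neg s => -eval φ bow s
  | interp s s' t t' => bow (eval φ bow s) (eval φ bow s') (eval φ bow t) (eval φ bow t')

theorem ITerm.eval_smul (φ : G →+ H) (bow : H → H → H → H → H) (m : ℕ) (s : ITerm G) :
    (ITerm.smul m s).eval φ bow = m • s.eval φ bow := by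
  induction m with
  | zero => simp [ITerm.smul, ITerm.eval]
  | succ m ih => simp [ITerm.smul, ITerm.eval, ih, succ_nsmul]

variable [PartialOrder G] [PartialOrder H] [IsOrderedAddMonoid H]

theorem ITerm.Le.eval_le {e : G} {φ : G →+ H} {bow : H → H → H → H → H} (hφ : Monotone φ)
    (hb : InterpLaws (φ e) bow) {s t : ITerm G} (h : ITerm.Le e s t) :
    s.eval φ bow ≤ t.eval φ bow := by
  induction h with
  | refl s => exact le_rfl
  | trans _ _ h₁ h₂ => exact h₁.trans h₂
  | of_le h => exact hφ h
  | of_add_le g h => simp [ITerm.eval]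
  | of_add_ge g h => simp [ITerm.eval]
  | add_assoc_le s t r => simp [ITerm.eval, add_assoc]
  | add_assoc_ge s t r => simp [ITerm.eval, add_assoc]
  | add_comm s t => exact (_root_.add_comm _ _).le
  | zero_add_le s => simp [ITerm.eval]
  | zero_add_ge s => simp [ITerm.eval]
  | neg_add_le s => simp [ITerm.eval]
  | neg_add_ge s => simp [ITerm.eval]
  | add_mono r _ h => exact add_le_add_left h _
  | neg_anti _ h => exact neg_le_neg h
  | point => simpa [ITerm.eval] using hb.point
  | unperf hm _ h =>
    simp only [ITerm.eval, ITerm.eval_smul, map_zero] at h ⊢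
    exact hb.unperf _ _ hm h
  | index _ _ h₁ h₂ =>
    simp only [ITerm.eval, ITerm.eval_smul, map_zero] at h₁ h₂ ⊢
    exact hb.index _ h₁ h₂
  | interp_left _ _ _ _ h₁ h₂ h₃ h₄ => exact (hb.interp _ _ _ _ h₁ h₂ h₃ h₄).1.1
  | interp_left' _ _ _ _ h₁ h₂ h₃ h₄ => exact (hb.interp _ _ _ _ h₁ h₂ h₃ h₄).1.2
  | interp_right _ _ _ _ h₁ h₂ h₃ h₄ => exact (hb.interp _ _ _ _ h₁ h₂ h₃ h₄).2.1
  | interp_right' _ _ _ _ h₁ h₂ h₃ h₄ => exact (hb.interp _ _ _ _ h₁ h₂ h₃ h₄).2.2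
  | interp_swap_left s s' t t' => exact (hb.swap_left _ _ _ _).le
  | interp_swap_right s s' t t' => exact (hb.swap_right _ _ _ _).le
  | interp_congr _ _ _ _ _ _ _ _ h₁ h₂ h₃ h₄ h₅ h₆ h₇ h₈ =>
    simp only [ITerm.eval, h₁.antisymm h₂, h₃.antisymm h₄, h₅.antisymm h₆, h₇.antisymm h₈]
    exact le_rfl

/-- The homomorphism `I(G) → H` induced by a homomorphism `φ` from `G` to a member `H` of the
class `𝒟`. -/
def I.lift {e : G} (φ : G →+ H) (bow : H → H → H → H → H) (hφ : Monotone φ)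
    (hb : InterpLaws (φ e) bow) : I G e →+ H where
  toFun := Quotient.lift (ITerm.eval φ bow) fun _ _ h =>
    (h.1.eval_le hφ hb).antisymm (h.2.eval_le hφ hb)
  map_zero' := map_zero φ
  map_add' x y := by
    induction x, y using Quotient.inductionOn₂ with
    | _ s t => rfl

theorem I.lift_monotone {e : G} (φ : G →+ H) (bow : H → H → H → H → H) (hφ : Monotone φ)
    (hb : InterpLaws (φ e) bow) : Monotone (I.lift φ bow hφ hb) := by
  intro x y
  induction x, y using Quotient.inductionOn₂ with
  | _ s t => exact fun h => ITerm.Le.eval_le hφ hb h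

theorem I.lift_eq_eval_out {e : G} (φ : G →+ H) (bow : H → H → H → H → H) (hφ : Monotone φ)
    (hb : InterpLaws (φ e) bow) (t : I G e) :
    I.lift φ bow hφ hb t = (Quotient.out t : ITerm G).eval φ bow := by
  conv_lhs => rw [← Quotient.out_eq t]
  rfl

end Lift

section LiftE

variable {X : Type u} {H : Type w} [AddCommGroup H]

/-- The homomorphism `E(X) → H` with `e ↦ u` and `a ξ ↦ A ξ`. -/
noncomputable def E.lift (u : H) (A : X → H) : E X →+ H :=
  ((zmultiplesHom H u).coprod (Finsupp.liftAddHom fun ν => zmultiplesHom H (A ν)) :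
    ℤ × (X →₀ ℤ) →+ H)

theorem E.lift_apply (u : H) (A : X → H) (g : E X) :
    E.lift u A g = g.1 • u + g.2.sum fun ν n => n • A ν := rfl

theorem E.lift_e (u : H) (A : X → H) : E.lift u A (E.e X) = u := by
  rw [E.lift_apply]
  simp [E.e]

theorem E.lift_a (u : H) (A : X → H) (ξ : X) : E.lift u A (E.a ξ) = A ξ := by
  rw [E.lift_apply]
  simp [E.a]

theorem E.lift_monotone [PartialOrder H] [IsOrderedAddMonoid H] {u : H} {A : X → H}
    (hu : 0 ≤ u) (hA : ∀ ν, 0 ≤ A ν ∧ A ν ≤ u) : Monotone (E.lift u A) := by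
  intro x y hxy
  have key : ∀ z ∈ E.cone X, 0 ≤ E.lift u A z := by
    intro z hz
    induction hz using AddSubmonoid.closure_induction with
    | mem z hz =>
      rcases hz with (rfl | ⟨ν, rfl⟩) | ⟨ν, rfl⟩
      · rwa [E.lift_e]
      · simpa only [E.lift_a] using (hA ν).1
      · simpa only [map_sub, E.lift_e, E.lift_a, sub_nonneg] using (hA ν).2
    | zero => rw [map_zero]
    | add x y _ _ hx hy => rw [map_add]; exact add_nonneg hx hy
  have := key _ hxy
  rwa [map_sub, sub_nonneg] at this

open Classical in
/-- The finite set of the generators of `E(X)` that occur in a term. -/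
noncomputable def ITerm.vars : ITerm (E X) → Finset X
  | of g => g.2.support
  | add s t => vars s ∪ vars t
  | neg s => vars s
  | interp s s' t t' => (vars s ∪ vars s') ∪ (vars t ∪ vars t')

/-- A finite support of an element of `F(X)`: the set of the generators that occur in a chosen
term for it. -/
noncomputable def F.supp (t : F X) : Finset X := (Quotient.out t : ITerm (E X)).vars

theorem ITerm.eval_mem {u : H} {A : X → H} {bow : H → H → H → H → H} (P : AddSubgroup H)
    (hu : u ∈ P) (hbow : ∀ x ∈ P, ∀ x' ∈ P, ∀ y ∈ P, ∀ y' ∈ P, bow x x' y y' ∈ P)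
    (T : ITerm (E X)) (hA : ∀ ν ∈ T.vars, A ν ∈ P) : T.eval (E.lift u A) bow ∈ P := by
  classical
  induction T with
  | of g =>
    rw [ITerm.eval, E.lift_apply]
    exact add_mem (zsmul_mem hu _) (sum_mem fun ν hν => zsmul_mem (hA ν hν) _)
  | add s t hs ht =>
    simp only [ITerm.vars, Finset.mem_union] at hA
    exact add_mem (hs fun ν h => hA ν (.inl h)) (ht fun ν h => hA ν (.inr h))
  | neg s hs => exact neg_mem (hs hA)
  | interp s s' t t' hs hs' ht ht' =>
    simp only [ITerm.vars, Finset.mem_union] at hA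
    exact hbow _ (hs fun ν h => hA ν (.inl (.inl h))) _ (hs' fun ν h => hA ν (.inl (.inr h)))
      _ (ht fun ν h => hA ν (.inr (.inl h))) _ (ht' fun ν h => hA ν (.inr (.inr h)))

end LiftE

/-! ### Valuations on a lattice -/

/-- The image in `Dim L` of the generator `Δ(x, y)`. -/
def Dim.delta {L : Type u} [Lattice L] (x y : L) (h : x ≤ y) : Dim L :=
  (addConGen (DimRel L)).mk' (formalDelta x y h)

section Valuation

variable {L : Type v} [Lattice L] {G : Type u} [AddCommGroup G]

theorem Dim.delta_add {x y z : L} (hxy : x ≤ y) (hyz : y ≤ z) :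
    Dim.delta x z (hxy.trans hyz) = Dim.delta x y hxy + Dim.delta y z hyz :=
  ((addConGen (DimRel L)).eq.2 (.of _ _ (.d1 x y z hxy hyz))).trans rfl

theorem Dim.delta_inf (x y : L) :
    Dim.delta (x ⊓ y) x inf_le_left = Dim.delta y (x ⊔ y) le_sup_right :=
  (addConGen (DimRel L)).eq.2 (.of _ _ (.d2 x y))

/-- A group-valued homomorphism on `Dim L` is integrated to a function on `L`, which is determined
up to a constant. -/
theorem exists_eq_sub [Nonempty L] (μ : Dim L →+ G) :
    ∃ r : L → G, ∀ (x y : L) (h : x ≤ y), μ (Dim.delta x y h) = r y - r x := by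
  obtain ⟨o⟩ := ‹Nonempty L›
  refine ⟨fun x => μ (Dim.delta (x ⊓ o) x inf_le_left) - μ (Dim.delta (x ⊓ o) o inf_le_right),
    fun x y h => ?_⟩
  have h' : x ⊓ o ≤ y ⊓ o := inf_le_inf_right o h
  -- the two ways from `x ⊓ o` up to `y`, and the way from `x ⊓ o` up to `o`
  have h₁ := congrArg μ (Dim.delta_add (inf_le_left : x ⊓ o ≤ x) h)
  have h₂ := congrArg μ (Dim.delta_add h' (inf_le_left : y ⊓ o ≤ y))
  have h₃ := congrArg μ (Dim.delta_add h' (inf_le_right : y ⊓ o ≤ o))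
  rw [map_add] at h₁ h₂ h₃
  rw [h₁] at h₂
  dsimp only
  rw [h₃, eq_sub_of_add_eq' h₂]
  abel

/-- The intervals of `L` on which a function `f` is constant. -/
def ConstOn (f : L → G) (J : Interval L) : Prop :=
  ∀ z, J.1.1 ≤ z → z ≤ J.1.2 → f z = f J.1.1

/-- Being constant on intervals respects the defining relations of `Dim L`, because `f` is modular.
Hence a summand of an element of `Dim L` is described by intervals on which `f` is constant as soon
as the element is, whether or not `Dim L` has the refinement property. -/
theorem constOn_iff_of_rel {f : L → G} (hf : ∀ x y, f (x ⊓ y) + f (x ⊔ y) = f x + f y)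
    {m m' : Multiset (Interval L)} (h : addConGen (DimRel L) m m') :
    (∀ J ∈ m, ConstOn f J) ↔ ∀ J ∈ m', ConstOn f J := by
  induction (h : AddConGen.Rel (DimRel L) m m') with
  | of m m' h =>
    cases h with
    | d0 x =>
      simp only [formalDelta, Multiset.mem_singleton, forall_eq, Multiset.notMem_zero,
        false_imp_iff, implies_true, iff_true]
      exact fun z h₁ h₂ => congrArg f (le_antisymm h₂ h₁)
    | d1 x y z hxy hyz =>
      simp only [formalDelta, Multiset.mem_singleton, forall_eq, Multiset.mem_add, or_imp,
        forall_and]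
      constructor
      · intro h
        exact ⟨fun t h₁ h₂ => h t h₁ (h₂.trans hyz),
          fun t h₁ h₂ => (h t (hxy.trans h₁) h₂).trans (h y hxy hyz).symm⟩
      · rintro ⟨h, h'⟩ t h₁ h₂
        have e₁ : f (t ⊓ y) = f x := h _ (le_inf h₁ hxy) inf_le_right
        have e₂ : f (t ⊔ y) = f y := h' _ le_sup_right (sup_le h₂ hyz)
        have := hf t y
        rw [e₁, e₂] at this
        exact (add_right_cancel this).symm
    | d2 x y =>
      simp only [formalDelta, Multiset.mem_singleton, forall_eq]
      have hxy := hf x y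
      constructor
      · intro h t h₁ h₂
        have e₁ : f (x ⊓ t) = f (x ⊓ y) := h _ (inf_le_inf_left x h₁) inf_le_left
        have e₂ : x ⊔ t = x ⊔ y := le_antisymm (sup_le le_sup_left h₂) (sup_le_sup_left h₁ x)
        have := hf x t
        rw [e₁, e₂, hxy] at this
        exact (add_left_cancel this).symm
      · intro h t h₁ h₂
        have e₁ : f (t ⊔ y) = f y := h _ le_sup_right (sup_le_sup_right h₂ y)
        have e₂ : t ⊓ y = x ⊓ y := le_antisymm (inf_le_inf_right y h₂) (le_inf h₁ inf_le_right)
        have := hf t y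
        rw [e₁, e₂] at this
        exact (add_right_cancel this).symm
  | refl => exact Iff.rfl
  | symm _ ih => exact ih.symm
  | trans _ _ ih ih' => exact ih.trans ih'
  | add _ _ ih ih' =>
    simp only [Multiset.mem_add, or_imp, forall_and]
    exact and_congr ih ih'

theorem map_mk_eq_sum (μ : Dim L →+ G) {r : L → G}
    (hr : ∀ (x y : L) (h : x ≤ y), μ (Dim.delta x y h) = r y - r x)
    (m : Multiset (Interval L)) :
    μ ((addConGen (DimRel L)).mk' m) = (m.map fun J => r J.1.2 - r J.1.1).sum := by
  induction m using Multiset.induction_on with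
  | empty => simp
  | cons J m ih =>
    rw [← Multiset.singleton_add, map_add, map_add, ih, Multiset.map_add, Multiset.sum_add]
    congr 1
    rw [Multiset.map_singleton, Multiset.sum_singleton]
    exact hr _ _ J.2

end Valuation

/-! ### Free triples -/

section FreeTriple

open Cardinal Set

/-- A form of Kuratowski's free set theorem: on a set with more than `ℵ₁` elements, every map from
pairs to finite subsets has a free triple, and the triple may be taken inside one class of a
finite partition. -/
theorem exists_free_triple {X : Type u} (hX : ℵ₁ < #X) (Φ : X → X → Finset X)
    {κ : Type v} [Finite κ] (f : X → κ) :
    ∃ ξ η ζ : X, ξ ≠ ζ ∧ f ξ = f η ∧ f η = f ζ ∧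
      ξ ∉ Φ η ζ ∧ η ∉ Φ ξ ζ ∧ ζ ∉ Φ ξ η := by
  -- a class `A` of the partition with more than `ℵ₁` elements
  obtain ⟨c, hc⟩ : ∃ c, ℵ₁ < #(f ⁻¹' {c}) := by
    obtain ⟨n, ⟨σ⟩⟩ := Finite.exists_equiv_fin κ
    obtain ⟨c, hc⟩ := infinite_pigeonhole_card (fun x => ULift.up.{u} (σ (f x))) (Order.succ ℵ₁)
      (Order.succ_le_of_lt hX) (aleph0_le_aleph 1 |>.trans (Order.le_succ _))
      (by
        rw [(isRegular_succ (aleph0_le_aleph 1)).cof_ord]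
        exact (lt_aleph0_of_finite _).trans_le ((aleph0_le_aleph 1).trans (Order.le_succ _)))
    refine ⟨σ.symm c.down, (Order.lt_succ _).trans_le (hc.trans (mk_le_mk_of_subset ?_))⟩
    rintro x rfl
    simp
  set A := f ⁻¹' {c} with hA
  obtain ⟨Y, hYA, hY⟩ := le_mk_iff_exists_subset.1 hc.le
  obtain ⟨ζ, hζA, hζ⟩ : ∃ ζ ∈ A, ζ ∉ Y ∪ ⋃ p : Y × Y, (Φ p.1 p.2 : Set X) := by
    by_contra! h
    refine hc.not_ge ((mk_le_mk_of_subset h).trans ((mk_union_le _ _).trans ?_))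
    have h1 : #(⋃ p : Y × Y, (Φ p.1 p.2 : Set X)) ≤ ℵ₁ := by
      refine (mk_iUnion_le _).trans ?_
      rw [mk_prod, lift_id, hY]
      refine mul_le_of_le (aleph0_le_aleph 1) (mul_le_of_le (aleph0_le_aleph 1) le_rfl le_rfl) ?_
      exact ciSup_le' fun p => (mk_le_aleph0.trans (aleph0_le_aleph 1))
    exact add_le_of_le (aleph0_le_aleph 1) hY.le h1
  simp only [mem_union, mem_iUnion, not_or, not_exists] at hζ
  have hYinf : Infinite Y := by
    rw [infinite_iff, hY]
    exact aleph0_le_aleph 1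
  let C : ℕ ↪ Y := Infinite.natEmbedding Y
  obtain ⟨η, hηY, hη⟩ : ∃ η ∈ Y, η ∉ range (fun n => (C n : X)) ∪ ⋃ n, (Φ (C n) ζ : Set X) := by
    by_contra! h
    have h1 : Y.Countable := ((countable_range _).union
      (countable_iUnion fun n => (Φ (C n) ζ).countable_toSet)).mono h
    rw [← le_aleph0_iff_set_countable, hY] at h1
    exact h1.not_gt aleph0_lt_aleph_one
  simp only [mem_union, mem_range, mem_iUnion, not_or, not_exists] at hη
  have hinf : (range fun n => (C n : X)).Infinite :=
    infinite_range_of_injective (Subtype.val_injective.comp C.injective)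
  obtain ⟨_, ⟨n, rfl⟩, hn⟩ := hinf.exists_notMem_finset (Φ η ζ)
  have hm : ∀ {x}, x ∈ Y → f x = c := fun hx => hYA hx
  refine ⟨C n, η, ζ, fun h => hζ.1 (h ▸ (C n).2),
    (hm (C n).2).trans (hm hηY).symm, (hm hηY).trans (Eq.symm hζA), hn, hη.2 n,
    hζ.2 (C n, ⟨η, hηY⟩)⟩

end FreeTriple

/-! ### Functions on the power set, with one additional coordinate -/

section Split

variable {X : Type u}

/-- A function of subsets of `X` does not depend on the point `ω`. -/
def IndepOf (ω : X) (f : Set X → ℤ) : Prop := ∀ S, f (insert ω S) = f S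

/-- A family, indexed by `K`, of requirements on the elements `f` of `(Set X → ℤ) × ℤ`: for
`k : K`, the requirement on the functions that do not depend on the point `avoid k` is that the
additional coordinate of `f` is the sum of the values of `f` at `α k` and `β k`. The requirements
are assumed to be compatible with each other, and to hold, for all `ν ≠ avoid k`, for the element
with first component `S ↦ [ν ∈ S]` and additional coordinate `q ν`. -/
structure Splitting (X : Type u) where
  K : Type
  avoid : K → X
  α : K → Set X
  β : K → Set X
  q : X → ℤ
  q_nonneg : ∀ ν, 0 ≤ q ν
  q_le : ∀ ν, q ν ≤ 2
  compat : ∀ k l g, IndepOf (avoid k) g → IndepOf (avoid l) g →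
    g (α k) + g (β k) = g (α l) + g (β l)
  gen : ∀ k ν, ν ≠ avoid k → q ν = (α k).indicator 1 ν + (β k).indicator 1 ν

/-- The subgroup of the elements that do not depend on `avoid k` and satisfy the requirement. -/
def Splitting.sub (P : Splitting X) (k : P.K) : AddSubgroup ((Set X → ℤ) × ℤ) where
  carrier := {f | IndepOf (P.avoid k) f.1 ∧ f.2 = f.1 (P.α k) + f.1 (P.β k)}
  zero_mem' := ⟨fun _ => rfl, rfl⟩
  add_mem' := by
    rintro f g ⟨hf, hf'⟩ ⟨hg, hg'⟩
    refine ⟨fun S => congrArg₂ (· + ·) (hf S) (hg S), ?_⟩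
    simp only [Prod.snd_add, Prod.fst_add, Pi.add_apply, hf', hg']
    ring
  neg_mem' := by
    rintro f ⟨hf, hf'⟩
    refine ⟨fun S => congrArg (- ·) (hf S), ?_⟩
    simp only [Prod.snd_neg, Prod.fst_neg, Pi.neg_apply, hf']
    ring

theorem Splitting.mem_sub {P : Splitting X} {k : P.K} {f : (Set X → ℤ) × ℤ} :
    f ∈ P.sub k ↔ IndepOf (P.avoid k) f.1 ∧ f.2 = f.1 (P.α k) + f.1 (P.β k) := Iff.rfl

open Classical in
/-- The interpolator on `(Set X → ℤ) × ℤ`: the join of the first two arguments, except that the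
additional coordinate is corrected, when this is necessary to stay in a subgroup `P.sub k` that
contains all four arguments. -/
noncomputable def Splitting.bow (P : Splitting X) (x x' y y' : (Set X → ℤ) × ℤ) :
    (Set X → ℤ) × ℤ :=
  (x.1 ⊔ x'.1,
    if h : ∃ k, x ∈ P.sub k ∧ x' ∈ P.sub k ∧ y ∈ P.sub k ∧ y' ∈ P.sub k then
      (x.1 ⊔ x'.1) (P.α h.choose) + (x.1 ⊔ x'.1) (P.β h.choose)
    else x.2 ⊔ x'.2)

theorem IndepOf.sup {ω : X} {f g : Set X → ℤ} (hf : IndepOf ω f) (hg : IndepOf ω g) :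
    IndepOf ω (f ⊔ g) := fun S => by
  simp only [Pi.sup_apply, hf S, hg S]

theorem Splitting.bow_snd {P : Splitting X} {x x' y y' : (Set X → ℤ) × ℤ} (k : P.K)
    (hx : x ∈ P.sub k) (hx' : x' ∈ P.sub k) (hy : y ∈ P.sub k) (hy' : y' ∈ P.sub k) :
    (P.bow x x' y y').2 = (x.1 ⊔ x'.1) (P.α k) + (x.1 ⊔ x'.1) (P.β k) := by
  have h : ∃ k, x ∈ P.sub k ∧ x' ∈ P.sub k ∧ y ∈ P.sub k ∧ y' ∈ P.sub k := ⟨k, hx, hx', hy, hy'⟩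
  simp only [Splitting.bow, dif_pos h]
  exact P.compat _ _ _ (h.choose_spec.1.1.sup h.choose_spec.2.1.1) (hx.1.sup hx'.1)

theorem Splitting.bow_snd_of_not {P : Splitting X} {x x' y y' : (Set X → ℤ) × ℤ}
    (h : ¬∃ k, x ∈ P.sub k ∧ x' ∈ P.sub k ∧ y ∈ P.sub k ∧ y' ∈ P.sub k) :
    (P.bow x x' y y').2 = x.2 ⊔ x'.2 := by
  simp only [Splitting.bow, dif_neg h]

theorem Splitting.bow_mem {P : Splitting X} {x x' y y' : (Set X → ℤ) × ℤ} (k : P.K)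
    (hx : x ∈ P.sub k) (hx' : x' ∈ P.sub k) (hy : y ∈ P.sub k) (hy' : y' ∈ P.sub k) :
    P.bow x x' y y' ∈ P.sub k :=
  ⟨hx.1.sup hx'.1, P.bow_snd k hx hx' hy hy'⟩

/-- With the distinguished element `(1, 2)`, the group `(Set X → ℤ) × ℤ` is a member of the class
`𝒟`: the value `2` of the additional coordinate is allowed because the index is at most `2`. -/
theorem Splitting.interpLaws (P : Splitting X) :
    InterpLaws (((1, 2) : (Set X → ℤ) × ℤ)) P.bow where
  point := ⟨fun _ => zero_le_one, zero_le_two⟩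
  unperf m x hm h := by
    have hm' : (0 : ℤ) < m := by exact_mod_cast hm
    refine ⟨fun S => ?_, ?_⟩
    · have h1 : (0 : ℤ) ≤ m • x.1 S := h.1 S
      rw [nsmul_eq_mul] at h1
      exact nonneg_of_mul_nonneg_right h1 hm'
    · have h1 : (0 : ℤ) ≤ m • x.2 := h.2
      rw [nsmul_eq_mul] at h1
      exact nonneg_of_mul_nonneg_right h1 hm'
  index x _ h := by
    refine ⟨fun S => ?_, ?_⟩
    · have h1 : 3 • x.1 S ≤ (1 : ℤ) := h.1 S
      rw [nsmul_eq_mul] at h1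
      push_cast at h1
      change x.1 S ≤ 0
      omega
    · have h1 : 3 • x.2 ≤ (2 : ℤ) := h.2
      rw [nsmul_eq_mul] at h1
      push_cast at h1
      change x.2 ≤ 0
      omega
  interp x x' y y' h₁ h₂ h₃ h₄ := by
    have a₁ : x.1 ≤ x.1 ⊔ x'.1 := le_sup_left
    have a₂ : x'.1 ≤ x.1 ⊔ x'.1 := le_sup_right
    have a₃ : x.1 ⊔ x'.1 ≤ y.1 := sup_le h₁.1 h₃.1
    have a₄ : x.1 ⊔ x'.1 ≤ y'.1 := sup_le h₂.1 h₄.1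
    by_cases h : ∃ k, x ∈ P.sub k ∧ x' ∈ P.sub k ∧ y ∈ P.sub k ∧ y' ∈ P.sub k
    · obtain ⟨k, hx, hx', hy, hy'⟩ := h
      refine ⟨⟨⟨a₁, ?_⟩, ⟨a₂, ?_⟩⟩, ⟨⟨a₃, ?_⟩, ⟨a₄, ?_⟩⟩⟩ <;> rw [P.bow_snd k hx hx' hy hy']
      · exact hx.2.le.trans (add_le_add (a₁ _) (a₁ _))
      · exact hx'.2.le.trans (add_le_add (a₂ _) (a₂ _))
      · exact (add_le_add (a₃ _) (a₃ _)).trans hy.2.ge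
      · exact (add_le_add (a₄ _) (a₄ _)).trans hy'.2.ge
    · refine ⟨⟨⟨a₁, ?_⟩, ⟨a₂, ?_⟩⟩, ⟨⟨a₃, ?_⟩, ⟨a₄, ?_⟩⟩⟩ <;> rw [P.bow_snd_of_not h]
      · exact le_sup_left
      · exact le_sup_right
      · exact sup_le h₁.2 h₃.2
      · exact sup_le h₂.2 h₄.2
  swap_left x x' y y' := by
    refine Prod.ext (sup_comm _ _) ?_
    by_cases h : ∃ k, x ∈ P.sub k ∧ x' ∈ P.sub k ∧ y ∈ P.sub k ∧ y' ∈ P.sub k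
    · obtain ⟨k, hx, hx', hy, hy'⟩ := h
      rw [P.bow_snd k hx hx' hy hy', P.bow_snd k hx' hx hy hy', sup_comm]
    · rw [P.bow_snd_of_not h, P.bow_snd_of_not fun ⟨k, a, b, c⟩ => h ⟨k, b, a, c⟩, sup_comm]
  swap_right x x' y y' := by
    refine Prod.ext rfl ?_
    by_cases h : ∃ k, x ∈ P.sub k ∧ x' ∈ P.sub k ∧ y ∈ P.sub k ∧ y' ∈ P.sub k
    · obtain ⟨k, hx, hx', hy, hy'⟩ := h
      rw [P.bow_snd k hx hx' hy hy', P.bow_snd k hx hx' hy' hy]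
    · rw [P.bow_snd_of_not h, P.bow_snd_of_not fun ⟨k, a, b, c, d⟩ => h ⟨k, a, b, d, c⟩]

theorem supLaws : InterpLaws (1 : Set X → ℤ) fun x x' _ _ => x ⊔ x' where
  point := fun _ => zero_le_one
  unperf m x hm h S := by
    have hm' : (0 : ℤ) < m := by exact_mod_cast hm
    have h1 : (0 : ℤ) ≤ m • x S := h S
    rw [nsmul_eq_mul] at h1
    exact nonneg_of_mul_nonneg_right h1 hm'
  index x _ h S := by
    have h1 : 3 • x S ≤ (1 : ℤ) := h S
    rw [nsmul_eq_mul] at h1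
    push_cast at h1
    change x S ≤ 0
    omega
  interp x x' y y' h₁ h₂ h₃ h₄ :=
    ⟨⟨le_sup_left, le_sup_right⟩, ⟨sup_le h₁ h₃, sup_le h₂ h₄⟩⟩
  swap_left x x' y y' := sup_comm _ _
  swap_right x x' y y' := rfl

/-- The element `S ↦ [ν ∈ S]` of `Set X → ℤ`, which is the image of the generator `a ν` of `F(X)`
under `F.eval`. -/
noncomputable def point (ν : X) : Set X → ℤ := fun S => S.indicator 1 ν

theorem point_nonneg (ν : X) : 0 ≤ point ν := fun _ => Set.indicator_nonneg (by simp) _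

theorem point_le_one (ν : X) : point ν ≤ 1 := fun S => by
  classical
  rw [point, Set.indicator_apply]
  split_ifs <;> simp

/-- The homomorphism from `F(X)` to the functions on the power set of `X`, with `e ↦ 1` and
`a ν ↦ (S ↦ [ν ∈ S])`, for the interpolator that takes joins. -/
noncomputable def F.eval : F X →+ (Set X → ℤ) :=
  I.lift (E.lift 1 point) (fun x x' _ _ => x ⊔ x')
    (E.lift_monotone (fun _ => zero_le_one) fun ν => ⟨point_nonneg ν, point_le_one ν⟩)
    (by rw [E.lift_e]; exact supLaws)

theorem F.eval_e : F.eval (F.e X) = 1 := E.lift_e 1 point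

theorem F.eval_a (ν : X) : F.eval (I.j (E.e X) (E.a ν)) = point ν := E.lift_a 1 point ν

theorem F.eval_monotone : Monotone (F.eval (X := X)) := I.lift_monotone _ _ _ _

/-- The element of `(Set X → ℤ) × ℤ` to which `Splitting.lift` sends the generator `a ν`. -/
noncomputable def Splitting.point (P : Splitting X) (ν : X) : (Set X → ℤ) × ℤ :=
  (DimGroup.point ν, P.q ν)

theorem Splitting.point_mem {P : Splitting X} {k : P.K} {ν : X} (h : ν ≠ P.avoid k) :
    P.point ν ∈ P.sub k := by
  classical
  refine ⟨fun S => ?_, P.gen k ν h⟩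
  simp [Splitting.point, DimGroup.point, Set.indicator_apply, h]

/-- The homomorphism from `F(X)` to `(Set X → ℤ) × ℤ` with `e ↦ (1, 2)` and `a ν ↦ P.point ν`, for
the interpolator `P.bow`. -/
noncomputable def Splitting.lift (P : Splitting X) : F X →+ (Set X → ℤ) × ℤ :=
  I.lift (E.lift (1, 2) P.point) P.bow
    (E.lift_monotone P.interpLaws.point fun ν =>
      ⟨⟨point_nonneg ν, P.q_nonneg ν⟩, ⟨point_le_one ν, P.q_le ν⟩⟩)
    (by rw [E.lift_e]; exact P.interpLaws)

theorem Splitting.lift_monotone (P : Splitting X) : Monotone P.lift := I.lift_monotone _ _ _ _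

/-- An element of `F(X)` that does not involve the generator of `P.avoid k` is sent to an element
that satisfies the `k`-th requirement. -/
theorem Splitting.lift_mem (P : Splitting X) (k : P.K) {t : F X} (ht : P.avoid k ∉ F.supp t) :
    P.lift t ∈ P.sub k := by
  rw [Splitting.lift, I.lift_eq_eval_out]
  refine ITerm.eval_mem (P.sub k) (Splitting.mem_sub.2 ⟨fun _ => rfl, rfl⟩)
    (fun x hx x' hx' y hy y' hy' => P.bow_mem k hx hx' hy hy') _
    fun ν hν => P.point_mem fun h => ht (h ▸ hν)

theorem Splitting.lift_fst (P : Splitting X) (t : F X) : (P.lift t).1 = F.eval t := by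
  rw [Splitting.lift, I.lift_eq_eval_out, F.eval, I.lift_eq_eval_out]
  induction (Quotient.out t : ITerm (E X)) with
  | of g =>
    simp only [ITerm.eval, E.lift_apply, Finsupp.sum, Prod.fst_add, Prod.fst_sum, Prod.smul_fst]
    rfl
  | add s t hs ht => exact congrArg₂ (· + ·) hs ht
  | neg s hs => exact congrArg (- ·) hs
  | interp s s' t t' hs hs' => exact congrArg₂ (· ⊔ ·) hs hs'

open Classical in
/-- The requirements for three points `ξ`, `η`, `ζ`. Under the requirement for the pair
`ξ`, `η`, or `η`, `ζ`, the additional coordinate is the sum of a point where both generators are `1`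
and a point where both are `0`; under the requirement for `ξ`, `ζ`, it is the sum of the two points
where exactly one of the two generators is `1`. -/
noncomputable def tripleSplitting {ξ η ζ : X} (h₃ : ξ ≠ ζ) : Splitting X where
  K := Fin 3
  avoid := ![ζ, ξ, η]
  α := ![{ξ, η}, {η, ζ}, {ξ}]
  β := ![∅, ∅, {ζ}]
  q ν := if ν = ξ ∨ ν = η ∨ ν = ζ then 1 else 0
  q_nonneg ν := by split_ifs <;> simp
  q_le ν := by split_ifs <;> simp
  compat k l g hk hl := by
    have d₁ (h : IndepOf ξ g) : g {ξ, η} = g {η} := h _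
    have d₂ (h : IndepOf η g) : g {ξ, η} = g {ξ} := by rw [Set.pair_comm]; exact h _
    have d₃ (h : IndepOf η g) : g {η, ζ} = g {ζ} := h _
    have d₄ (h : IndepOf ζ g) : g {η, ζ} = g {η} := by rw [Set.pair_comm]; exact h _
    have d₅ (x : X) (h : IndepOf x g) : g {x} = g ∅ := by
      rw [← insert_empty_eq]; exact h _
    fin_cases k <;> fin_cases l <;> simp at hk hl ⊢
    · rw [d₁ hl, d₄ hk]
    · rw [d₂ hl, d₅ ζ hk]
    · rw [d₁ hk, d₄ hl]
    · rw [d₃ hl, d₅ ξ hk, add_comm]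
    · rw [d₂ hk, d₅ ζ hl]
    · rw [d₃ hk, d₅ ξ hl, add_comm]
  gen k ν h := by
    fin_cases k <;> simp [Set.indicator_apply] at h ⊢ 
    · simp [h]
    · simp [h]
    · by_cases e : ν = ξ
      · subst e
        simp [h₃]
      · simp [e, h]

end Split

/-! ### Intervals in a lattice with values in `F(X)` -/

section Contradiction

variable {X : Type u} {L : Type v} [Lattice L]

/-- A homomorphism `f` that does not vanish on some summand of an element `c` of `Dim L` is not
constant along some interval that occurs in a given expression of `c`. -/
theorem exists_mem_interval_ne {G : Type u} [AddCommGroup G] {μ : Dim L →+ G} {r : L → G}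
    (hr : ∀ (x y : L) (h : x ≤ y), μ (Dim.delta x y h) = r y - r x)
    (hmod : ∀ x y, r (x ⊓ y) + r (x ⊔ y) = r x + r y) {m ma mb : Multiset (Interval L)}
    (h : addConGen (DimRel L) m (ma + mb)) (f : G →+ ℤ)
    (hf : f (μ ((addConGen (DimRel L)).mk' ma)) ≠ 0) :
    ∃ J ∈ m, ∃ z, J.1.1 ≤ z ∧ z ≤ J.1.2 ∧ f (r z) ≠ f (r J.1.1) := by
  by_contra! hcon
  have hc : ∀ J ∈ ma, ConstOn (fun t => f (r t)) J := fun J hJ =>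
    (constOn_iff_of_rel (f := fun t => f (r t))
      (fun x y => by rw [← map_add, hmod, map_add]) h).1 hcon J (Multiset.mem_add.2 (.inl hJ))
  refine hf ?_
  rw [map_mk_eq_sum μ hr, map_multiset_sum, Multiset.map_map]
  refine Multiset.sum_eq_zero fun n hn => ?_
  obtain ⟨J, hJ, rfl⟩ := Multiset.mem_map.1 hn
  simp only [Function.comp_apply, map_sub]
  exact sub_eq_zero.2 (hc J hJ _ J.2 le_rfl)

/-- The elements `A`, `B`, `C` of `[u, y]` behave like subspaces of a space whose dimension is at
most `1` at each subset of `X`, and at most `2` at the additional coordinate. At the latter, `B` has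
dimension `1`, and the requirements of `tripleSplitting` force `A ⊓ B` and `B ⊓ C` to have dimension
at least `1`, and `A ⊓ C` to have dimension `0`: both `A` and `C` meet the line `B` in all of it,
but they do not meet each other. -/
theorem false_of_free_triple {r : L → F X} (hmono : Monotone r)
    (hmod : ∀ x y, r (x ⊓ y) + r (x ⊔ y) = r x + r y) {u y A B C : L}
    (huA : u ≤ A) (hAy : A ≤ y) (huB : u ≤ B) (hBy : B ≤ y) (huC : u ≤ C) (hCy : C ≤ y)
    (he : r y - r u ≤ F.e X) {ξ η ζ : X} (h₃ : ξ ≠ ζ)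
    {Φ : L → L → Finset X}
    (hΦ : ∀ s t, F.supp (r u) ⊆ Φ s t ∧ F.supp (r s) ⊆ Φ s t ∧ F.supp (r t) ⊆ Φ s t ∧
      F.supp (r (s ⊓ t)) ⊆ Φ s t)
    (hξ : ξ ∉ Φ B C) (hη : η ∉ Φ A C) (hζ : ζ ∉ Φ A B)
    {b : ℤ} (hA : F.eval (r A - r u) ∅ = b) (hB : F.eval (r B - r u) ∅ = b)
    (hC : F.eval (r C - r u) ∅ = b) (hA' : F.eval (r A - r u) {ξ} = 1 - b)
    (hB' : F.eval (r B - r u) {η} = 1 - b) (hC' : F.eval (r C - r u) {ζ} = 1 - b) : False := by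
  set P := tripleSplitting (η := η) h₃ with hP
  set f : L → Set X → ℤ := fun t => F.eval (r t - r u) with hf
  set q : L → ℤ := fun t => (P.lift (r t - r u)).2 with hq
  have fmono {s t : L} (h : s ≤ t) (S : Set X) : f s S ≤ f t S :=
    F.eval_monotone (sub_le_sub_right (hmono h) _) S
  have qmono {s t : L} (h : s ≤ t) : q s ≤ q t :=
    (P.lift_monotone (sub_le_sub_right (hmono h) _)).2
  have mod' (s t : L) : (r (s ⊓ t) - r u) + (r (s ⊔ t) - r u) = (r s - r u) + (r t - r u) := by
    rw [sub_add_sub_comm, hmod, sub_add_sub_comm]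
  have fmod (s t : L) (S : Set X) : f (s ⊓ t) S + f (s ⊔ t) S = f s S + f t S := by
    have := congrArg F.eval (mod' s t)
    rw [map_add, map_add] at this
    exact congrFun this S
  have qmod (s t : L) : q (s ⊓ t) + q (s ⊔ t) = q s + q t := by
    have := congrArg P.lift (mod' s t)
    rw [map_add, map_add] at this
    exact congrArg Prod.snd this
  have f_nonneg {t : L} (h : u ≤ t) (S : Set X) : 0 ≤ f t S := by
    have := fmono h S
    simpa [hf] using this
  have f_le {t : L} (h : t ≤ y) (S : Set X) : f t S ≤ 1 := by
    have := F.eval_monotone ((sub_le_sub_right (hmono h) (r u)).trans he) S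
    rwa [F.eval_e] at this
  -- membership in the three subgroups
  have mem (k : P.K) {t : L} (hu : P.avoid k ∉ F.supp (r u)) (ht : P.avoid k ∉ F.supp (r t)) :
      P.lift (r t - r u) ∈ P.sub k := by
    rw [map_sub]
    exact sub_mem (P.lift_mem k ht) (P.lift_mem k hu)
  have q_eq (k : P.K) {t : L} (hu : P.avoid k ∉ F.supp (r u)) (ht : P.avoid k ∉ F.supp (r t)) :
      q t = f t (P.α k) + f t (P.β k) := by
    have := (mem k hu ht).2
    rwa [P.lift_fst] at this
  have indep (k : P.K) {t : L} (hu : P.avoid k ∉ F.supp (r u)) (ht : P.avoid k ∉ F.supp (r t)) :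
      IndepOf (P.avoid k) (f t) := by
    have := (mem k hu ht).1
    rwa [P.lift_fst] at this
  obtain ⟨uAB, sA, sB, sAB⟩ := hΦ A B
  obtain ⟨uBC, sB', sC, sBC⟩ := hΦ B C
  obtain ⟨uAC, sA', sC', sAC⟩ := hΦ A C
  have no {x : X} {s t : Finset X} (h : x ∉ t) (hs : s ⊆ t) : x ∉ s := fun h' => h (hs h')
  have Aη : IndepOf η (f A) := indep (2 : Fin 3) (no hη uAC) (no hη sA')
  have Aζ : IndepOf ζ (f A) := indep (0 : Fin 3) (no hζ uAB) (no hζ sA)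
  have Bζ : IndepOf ζ (f B) := indep (0 : Fin 3) (no hζ uAB) (no hζ sB)
  have Bξ : IndepOf ξ (f B) := indep (1 : Fin 3) (no hξ uBC) (no hξ sB')
  have Cξ : IndepOf ξ (f C) := indep (1 : Fin 3) (no hξ uBC) (no hξ sC)
  have Cη : IndepOf η (f C) := indep (2 : Fin 3) (no hη uAC) (no hη sC')
  have qB : q B = f B {ξ, η} + f B ∅ := q_eq (0 : Fin 3) (no hζ uAB) (no hζ sB)
  have qAB : q (A ⊓ B) = f (A ⊓ B) {ξ, η} + f (A ⊓ B) ∅ :=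
    q_eq (0 : Fin 3) (no hζ uAB) (no hζ sAB)
  have qBC : q (B ⊓ C) = f (B ⊓ C) {η, ζ} + f (B ⊓ C) ∅ :=
    q_eq (1 : Fin 3) (no hξ uBC) (no hξ sBC)
  have qAC : q (A ⊓ C) = f (A ⊓ C) {ξ} + f (A ⊓ C) {ζ} :=
    q_eq (2 : Fin 3) (no hη uAC) (no hη sAC)
  change f A ∅ = b at hA
  change f B ∅ = b at hB
  change f C ∅ = b at hC
  change f A {ξ} = 1 - b at hA'
  change f B {η} = 1 - b at hB'
  change f C {ζ} = 1 - b at hC'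
  clear mem q_eq indep
  clear_value f q
  have sing {x : X} {g : Set X → ℤ} (h : IndepOf x g) : g {x} = g ∅ := by
    rw [← insert_empty_eq]
    exact h _
  have Aξη : f A {ξ, η} = 1 - b := by rw [Set.pair_comm, Aη, hA']
  have Bξη : f B {ξ, η} = 1 - b := by rw [Bξ, hB']
  have Bηζ : f B {η, ζ} = 1 - b := by rw [Set.pair_comm, Bζ, hB']
  have Cηζ : f C {η, ζ} = 1 - b := by rw [Cη, hC']
  have Aζ' : f A {ζ} = b := (sing Aζ).trans hA
  have Cξ' : f C {ξ} = b := (sing Cξ).trans hC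
  have qB1 : q B = 1 := by rw [qB, Bξη, hB]; ring
  -- at one of `{ξ, η}`, `∅`, both `A` and `B` have dimension `1`, and `A ⊔ B` has no more than that
  have qAB1 : 1 ≤ q (A ⊓ B) := by
    have a₁ := fmod A B {ξ, η}
    have a₂ := fmod A B ∅
    have a₃ := f_le (sup_le hAy hBy) {ξ, η}
    have a₄ := f_le (sup_le hAy hBy) ∅
    have a₅ := f_nonneg (le_inf huA huB) {ξ, η}
    have a₆ := f_nonneg (le_inf huA huB) ∅
    omega
  have qBC1 : 1 ≤ q (B ⊓ C) := by
    have a₁ := fmod B C {η, ζ}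
    have a₂ := fmod B C ∅
    have a₃ := f_le (sup_le hBy hCy) {η, ζ}
    have a₄ := f_le (sup_le hBy hCy) ∅
    have a₅ := f_nonneg (le_inf huB huC) {η, ζ}
    have a₆ := f_nonneg (le_inf huB huC) ∅
    omega
  -- at each of `{ξ}`, `{ζ}`, one of `A`, `C` has dimension `0`
  have qAC0 : q (A ⊓ C) ≤ 0 := by
    have a₁ := fmono (inf_le_left : A ⊓ C ≤ A) {ξ}
    have a₂ := fmono (inf_le_right : A ⊓ C ≤ C) {ξ}
    have a₃ := fmono (inf_le_left : A ⊓ C ≤ A) {ζ}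
    have a₄ := fmono (inf_le_right : A ⊓ C ≤ C) {ζ}
    omega
  -- `A ⊓ B` and `B ⊓ C` lie below `B`, and their meet lies below `A ⊓ C`
  have c₁ := qmod (A ⊓ B) (B ⊓ C)
  have c₂ : q ((A ⊓ B) ⊓ (B ⊓ C)) ≤ q (A ⊓ C) :=
    qmono (inf_le_inf inf_le_left inf_le_right)
  have c₃ : q ((A ⊓ B) ⊔ (B ⊓ C)) ≤ q B := qmono (sup_le inf_le_right inf_le_left)
  omega

end Contradiction

end DimGroup

open DimGroup in
/-- The monoid `{x : F X // 0 ≤ x}` is the positive cone of `F(X)`. -/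
theorem mainTheorem1 (X : Type u) (L : Type v) [Lattice L]
    (μ : Dim L →+ {x : F X // 0 ≤ x}) (hμ : IsVHom μ)
    (he : (⟨F.e X, F.e_nonneg X⟩ : {x : F X // 0 ≤ x}) ∈ Set.range μ) :
    Cardinal.mk X ≤ Cardinal.aleph 1 := by
  classical
  by_contra! hX
  obtain ⟨c, hc⟩ := he
  obtain ⟨m, rfl⟩ := (addConGen (DimRel L)).mk'_surjective c
  set μ' : Dim L →+ F X := (Nonneg.coeAddMonoidHom).comp μ with hμ'
  have hce : μ' ((addConGen (DimRel L)).mk' m) = F.e X := congrArg Subtype.val hc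
  have hL : Nonempty L := by
    by_contra! hL
    have : m = 0 := Multiset.eq_zero_of_forall_notMem fun J => hL.elim J.1.1
    rw [this, map_zero, map_zero] at hce
    have h1 := congrFun (F.eval_e (X := X)) ∅
    rw [← hce, map_zero] at h1
    exact zero_ne_one h1
  obtain ⟨r, hr⟩ := exists_eq_sub μ'
  have hmono : Monotone r := fun x y h => by
    rw [← sub_nonneg, ← hr x y h]
    exact (μ _).2
  have hmod (x y : L) : r (x ⊓ y) + r (x ⊔ y) = r x + r y := by
    have h := congrArg μ' (Dim.delta_inf x y)
    rw [hr, hr, sub_eq_sub_iff_add_eq_add] at h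
    rw [h, add_comm]
  have hle (J : DimGroup.Interval L) (hJ : J ∈ m) : r J.1.2 - r J.1.1 ≤ F.e X := by
    rw [← hce, map_mk_eq_sum μ' hr]
    refine Multiset.single_le_sum ?_ _ (Multiset.mem_map_of_mem _ hJ)
    intro t ht
    obtain ⟨I, _, rfl⟩ := Multiset.mem_map.1 ht
    exact sub_nonneg.2 (hmono I.2)
  -- apply the V-condition to `e = a ξ + (e - a ξ)`
  have hsep (ξ : X) : ∃ J ∈ m, ∃ z, ∃ b : Bool, J.1.1 ≤ z ∧ z ≤ J.1.2 ∧
      F.eval (r z - r J.1.1) ∅ = b.toInt ∧ F.eval (r z - r J.1.1) {ξ} = 1 - b.toInt := by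
    have hpos : 0 ≤ I.j (E.e X) (E.a ξ) := ITerm.Le.of_le (by
      change E.a ξ - 0 ∈ E.cone X
      rw [sub_zero]
      exact AddSubmonoid.subset_closure (.inl (.inr ⟨ξ, rfl⟩)))
    have hpos' : I.j (E.e X) (E.a ξ) ≤ F.e X := ITerm.Le.of_le
      (AddSubmonoid.subset_closure (.inr ⟨ξ, rfl⟩))
    obtain ⟨a, b, hab, ha, -⟩ := hμ _ ⟨I.j (E.e X) (E.a ξ), hpos⟩ ⟨_, sub_nonneg.2 hpos'⟩
      (hc.trans (Subtype.ext (add_sub_cancel _ _).symm))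
    obtain ⟨ma, rfl⟩ := (addConGen (DimRel L)).mk'_surjective a
    obtain ⟨mb, rfl⟩ := (addConGen (DimRel L)).mk'_surjective b
    rw [← map_add] at hab
    -- `f` takes the value `1` at `a ξ`
    let f : F X →+ ℤ := AddMonoidHom.mk' (fun t => F.eval t {ξ} - F.eval t ∅) fun s t => by
      rw [map_add]
      exact add_sub_add_comm _ _ _ _
    have hfa : f (μ' ((addConGen (DimRel L)).mk' ma)) ≠ 0 := by
      have : μ' ((addConGen (DimRel L)).mk' ma) = I.j (E.e X) (E.a ξ) := congrArg Subtype.val ha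
      rw [this]
      change F.eval _ {ξ} - F.eval _ ∅ ≠ 0
      rw [F.eval_a]
      simp [point]
    obtain ⟨J, hJ, z, h₁, h₂, h₃⟩ :=
      exists_mem_interval_ne hr hmod ((addConGen (DimRel L)).eq.1 hab) f hfa
    have hne : F.eval (r z - r J.1.1) {ξ} ≠ F.eval (r z - r J.1.1) ∅ := fun h => h₃ (by
      rw [← sub_eq_zero, ← map_sub]
      exact sub_eq_zero.2 h)
    -- both values lie between `0` and `1`, hence one of them is `0` and the other one is `1`
    have h0 (S : Set X) : 0 ≤ F.eval (r z - r J.1.1) S := by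
      have := F.eval_monotone (sub_nonneg.2 (hmono h₁)) S
      rwa [map_zero] at this
    have h1 (S : Set X) : F.eval (r z - r J.1.1) S ≤ 1 := by
      have := F.eval_monotone ((sub_le_sub_right (hmono h₂) _).trans (hle _ hJ)) S
      rwa [F.eval_e] at this
    have a₁ := h0 ∅
    have a₂ := h1 ∅
    have a₃ := h0 {ξ}
    have a₄ := h1 {ξ}
    refine ⟨J, hJ, z, decide (F.eval (r z - r J.1.1) ∅ = 1), h₁, h₂, ?_⟩
    by_cases h : F.eval (r z - r J.1.1) ∅ = 1
    · rw [decide_eq_true h, Bool.toInt_true]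
      omega
    · rw [decide_eq_false h, Bool.toInt_false]
      omega
  choose J hJ z b hz hz' hb hb' using hsep
  obtain ⟨ξ, η, ζ, d, c₁, c₂, k₁, k₂, k₃⟩ := exists_free_triple hX
    (fun ξ η => (F.supp (r (J ξ).1.1) ∪ F.supp (r (z ξ))) ∪
      (F.supp (r (z η)) ∪ F.supp (r (z ξ ⊓ z η))))
    (fun ξ => ((⟨J ξ, Multiset.mem_toFinset.2 (hJ ξ)⟩ : m.toFinset), b ξ))
  simp only [Prod.mk.injEq, Subtype.mk.injEq] at c₁ c₂
  obtain ⟨e₁, c₁⟩ := c₁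
  obtain ⟨e₂, c₂⟩ := c₂
  have key (ν : X) (hν : J ξ = J ν) (hν' : b ξ = b ν) : (J ξ).1.1 ≤ z ν ∧ z ν ≤ (J ξ).1.2 ∧
      F.eval (r (z ν) - r (J ξ).1.1) ∅ = (b ξ).toInt ∧
      F.eval (r (z ν) - r (J ξ).1.1) {ν} = 1 - (b ξ).toInt := by
    rw [hν, hν']
    exact ⟨hz ν, hz' ν, hb ν, hb' ν⟩
  obtain ⟨uξ, yξ, vξ, wξ⟩ := key ξ rfl rfl
  obtain ⟨uη, yη, vη, wη⟩ := key η e₁ c₁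
  obtain ⟨uζ, yζ, vζ, wζ⟩ := key ζ (e₁.trans e₂) (c₁.trans c₂)
  rw [← e₁] at k₁
  refine false_of_free_triple hmono hmod uξ yξ uη yη uζ yζ (hle _ (hJ ξ)) d
    (Φ := fun s t => (F.supp (r (J ξ).1.1) ∪ F.supp (r s)) ∪ (F.supp (r t) ∪ F.supp (r (s ⊓ t))))
    (fun s t => ⟨?_, ?_, ?_, ?_⟩) k₁ k₂ k₃ vξ vη vζ wξ wη wζ
  · exact Finset.subset_union_left.trans Finset.subset_union_left
  · exact Finset.subset_union_right.trans Finset.subset_union_left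
  · exact Finset.subset_union_left.trans Finset.subset_union_right
  · exact Finset.subset_union_right.trans Finset.subset_union_right
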